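/- Consider, for $\theta_0\in\mathbb R$ and a locally bounded real potential $V$ on $[0,\infty)$, the operator $$H^{\theta_0}\varphi=-\varphi''+V\varphi$$ in $L^2([0,\infty);\mathbb C)$, with domain the restrictions to $[0,\infty)$ of the functions $\varphi\in C_c^\infty(\mathbb R;\mathbb C)$ such that $\varphi(0)\cos\theta_0-\varphi'(0)\sin\theta_0=0$. An operator is called essentially self-adjoint if it is densely defined and symmetric and its closure is self-adjoint. **Model II.** Let $(X_n)_{n\ge0}$ be i.i.d. random variables on a probability space $(\Omega,\mathcal F,P)$ with a common density $p$ that is bounded and continuous, with $p(x)>0$ for $x>0$ and $p(x)=0$ for $x\le0$, and let $$V(x,\omega)=-\sum_{n=0}^\infty 1_{[n,n+1)}(x)\,X_n(\omega).$$ **Model IV.** Let $(X_n)_{n\ge1}$ be i.i.d. nonnegative random variables such that $\sqrt{X_n}$ has density $p_1$, let $(Y_n)_{n\ge1}$ be i.i.d. random variables with density $p_2$, where $p_1,p_2$ are bounded, positive on $(0,\infty)$ and zero on $(-\infty,0)$, and let $(\varepsilon_n)_{n\ge1}$ be i.i.d. with $P(\varepsilon_n=0)=P(\varepsilon_n=1)=\tfrac12$,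 the sequence $(\varepsilon_n)$ being independent of $(X_n,Y_n)_{n\ge1}$. Put $L_n=\sum_{j=1}^nY_j+n$ and $$V(x,\omega)=\sum_{n=1}^\infty(-1)^{\varepsilon_n(\omega)}X_n(\omega)\,1_{[L_n(\omega)-1,\,L_n(\omega)]}(x).$$ No assumption is made on the tails of the distributions of $X_n$ and $Y_n$. Then, in each of the two models, for $P$-almost every $\omega$ the operator $H^{\theta_0}$ with potential $V(\cdot,\omega)$ is essentially self-adjoint for every $\theta_0\in\mathbb R$. -/

import Mathlib

open MeasureTheory ProbabilityTheory Set


noncomputable section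

namespace KronigPenny

/-! ### Essential self-adjointness -/

/-- A densely defined symmetric operator on a complex Hilbert space is essentially self-adjoint
if its closure is self-adjoint. -/
def IsEssentiallySelfAdjoint {E : Type*} [NormedAddCommGroup E] [InnerProductSpace ℂ E]
    [CompleteSpace E] (T : E →ₗ.[ℂ] E) : Prop :=
  Dense (T.domain : Set E) ∧ T.IsFormalAdjoint T ∧ IsSelfAdjoint T.closure

/-! ### The Schrödinger operator on the half line -/

/-- Lebesgue measure on the half line `[0, ∞)`. -/
abbrev halfLine : Measure ℝ := volume.restrict (Ici 0)

/-- The Hilbert space `L²([0, ∞); ℂ)`. -/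
abbrev L2 : Type := Lp ℂ 2 halfLine

/-- The functions `φ` whose restrictions to `[0, ∞)` form the domain: smooth, compactly supported,
and satisfying the boundary condition `φ(0) cos θ₀ - φ'(0) sin θ₀ = 0`. -/
structure IsTest (θ₀ : ℝ) (φ : ℝ → ℂ) : Prop where
  smooth : ContDiff ℝ (⊤ : ℕ∞) φ
  compact : HasCompactSupport φ
  boundary : φ 0 * (Real.cos θ₀ : ℂ) - deriv φ 0 * (Real.sin θ₀ : ℂ) = 0

/-- The differential expression `-φ'' + V φ`. -/
def expr (V : ℝ → ℝ) (φ : ℝ → ℂ) (x : ℝ) : ℂ := -deriv (deriv φ) x + (V x : ℂ) * φ x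

theorem IsTest.differentiable {θ₀ : ℝ} {φ : ℝ → ℂ} (h : IsTest θ₀ φ) : Differentiable ℝ φ :=
  h.smooth.differentiable (by simp)

theorem IsTest.differentiable_deriv {θ₀ : ℝ} {φ : ℝ → ℂ} (h : IsTest θ₀ φ) :
    Differentiable ℝ (deriv φ) :=
  ((contDiff_infty_iff_deriv.1 h.smooth).2).differentiable (by simp)

theorem IsTest.zero (θ₀ : ℝ) : IsTest θ₀ 0 where
  smooth := contDiff_const
  compact := HasCompactSupport.zero
  boundary := by simp

theorem IsTest.add {θ₀ : ℝ} {φ ψ : ℝ → ℂ} (h : IsTest θ₀ φ) (k : IsTest θ₀ ψ) :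
    IsTest θ₀ (φ + ψ) where
  smooth := h.smooth.add k.smooth
  compact := h.compact.add k.compact
  boundary := by
    rw [deriv_add (h.differentiable 0) (k.differentiable 0), Pi.add_apply]
    linear_combination h.boundary + k.boundary

theorem IsTest.smul {θ₀ : ℝ} {φ : ℝ → ℂ} (c : ℂ) (h : IsTest θ₀ φ) : IsTest θ₀ (c • φ) where
  smooth := h.smooth.const_smul c
  compact := h.compact.mono (Function.support_const_smul_subset c φ)
  boundary := by
    rw [deriv_const_smul c (h.differentiable 0), Pi.smul_apply, smul_eq_mul, smul_eq_mul]
    linear_combination c * h.boundary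

theorem expr_add {θ₀ : ℝ} (V : ℝ → ℝ) {φ ψ : ℝ → ℂ} (h : IsTest θ₀ φ) (k : IsTest θ₀ ψ) :
    expr V (φ + ψ) = expr V φ + expr V ψ := by
  have e : deriv (φ + ψ) = deriv φ + deriv ψ :=
    funext fun x => deriv_add (h.differentiable x) (k.differentiable x)
  funext x
  simp only [expr, e, Pi.add_apply,
    deriv_add (h.differentiable_deriv x) (k.differentiable_deriv x)]
  ring

theorem expr_smul {θ₀ : ℝ} (V : ℝ → ℝ) (c : ℂ) {φ : ℝ → ℂ} (h : IsTest θ₀ φ) :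
    expr V (c • φ) = c • expr V φ := by
  have e : deriv (c • φ) = c • deriv φ :=
    funext fun x => deriv_const_smul c (h.differentiable x)
  funext x
  simp only [expr, e, Pi.smul_apply, smul_eq_mul, deriv_const_smul c (h.differentiable_deriv x)]
  ring

/-- The graph of the operator: pairs of `L²` classes `(φ, -φ'' + V φ)` with `φ` as in `IsTest`
(for locally bounded measurable `V` every such `φ` occurs). -/
def schrodingerGraph (V : ℝ → ℝ) (θ₀ : ℝ) : Submodule ℂ (L2 × L2) where
  carrier := {z | ∃ φ : ℝ → ℂ, IsTest θ₀ φ ∧ z.1 =ᵐ[halfLine] φ ∧ z.2 =ᵐ[halfLine] expr V φ}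
  zero_mem' := by
    refine ⟨0, IsTest.zero θ₀, Lp.coeFn_zero _ _ _, ?_⟩
    have e : expr V 0 = 0 := by
      have d : deriv (0 : ℝ → ℂ) = 0 := funext fun x => deriv_const x 0
      funext x; simp [expr, d]
    rw [e]
    exact Lp.coeFn_zero _ _ _
  add_mem' := by
    rintro z w ⟨φ, h, h₁, h₂⟩ ⟨ψ, k, k₁, k₂⟩
    refine ⟨φ + ψ, h.add k, (Lp.coeFn_add _ _).trans (h₁.add k₁), ?_⟩
    rw [expr_add V h k]
    exact (Lp.coeFn_add _ _).trans (h₂.add k₂)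
  smul_mem' := by
    rintro c z ⟨φ, h, h₁, h₂⟩
    refine ⟨c • φ, h.smul c, (Lp.coeFn_smul _ _).trans (h₁.const_smul c), ?_⟩
    rw [expr_smul V c h]
    exact (Lp.coeFn_smul _ _).trans (h₂.const_smul c)

/-- The operator `H^{θ₀} φ = -φ'' + V φ` in `L²([0, ∞); ℂ)`. -/
def schrodinger (V : ℝ → ℝ) (θ₀ : ℝ) : L2 →ₗ.[ℂ] L2 := (schrodingerGraph V θ₀).toLinearPMap

/-- The operator is well defined: its graph is single valued. -/
theorem schrodingerGraph_functional (V : ℝ → ℝ) (θ₀ : ℝ) (z : L2 × L2)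
    (hz : z ∈ schrodingerGraph V θ₀) (h0 : z.1 = 0) : z.2 = 0 := by
  obtain ⟨φ, h, h₁, h₂⟩ := hz
  rw [h0] at h₁
  have hφ : φ =ᵐ[volume.restrict (Ioi 0)] (0 : ℝ → ℂ) :=
    ae_restrict_of_ae_restrict_of_subset Ioi_subset_Ici_self
      (h₁.symm.trans (Lp.coeFn_zero _ _ _))
  have hE : EqOn φ 0 (Ioi 0) :=
    Measure.eqOn_open_of_ae_eq hφ isOpen_Ioi h.smooth.continuous.continuousOn continuousOn_const
  have hD : EqOn (deriv φ) 0 (Ioi 0) := fun x hx => by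
    have : φ =ᶠ[nhds x] fun _ => (0 : ℂ) := hE.eventuallyEq_of_mem (isOpen_Ioi.mem_nhds hx)
    rw [this.deriv_eq, deriv_const]; rfl
  have hD2 : EqOn (deriv (deriv φ)) 0 (Ioi 0) := fun x hx => by
    have : deriv φ =ᶠ[nhds x] fun _ => (0 : ℂ) := hD.eventuallyEq_of_mem (isOpen_Ioi.mem_nhds hx)
    rw [this.deriv_eq, deriv_const]; rfl
  rw [Lp.eq_zero_iff_ae_eq_zero]
  refine h₂.trans ?_
  rw [halfLine, ← Measure.restrict_congr_set (Ioi_ae_eq_Ici (μ := volume) (a := (0 : ℝ)))]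
  filter_upwards [ae_restrict_mem measurableSet_Ioi] with x hx
  simp [expr, hE hx, hD2 hx]

theorem schrodinger_graph (V : ℝ → ℝ) (θ₀ : ℝ) :
    (schrodinger V θ₀).graph = schrodingerGraph V θ₀ :=
  Submodule.toLinearPMap_graph_eq _ (schrodingerGraph_functional V θ₀)

/-! ### The two random potentials -/

/-- `V(x) = -∑_{n ≥ 0} 1_{[n, n+1)}(x) X_n`, for one realisation of the heights. -/
def potentialII (X : ℕ → ℝ) (x : ℝ) : ℝ :=
  -∑' n : ℕ, (Ico (n : ℝ) (n + 1)).indicator (fun _ => X n) x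

/-- The right edge `L_n = Y_1 + ⋯ + Y_n + n` of the `n`-th bump. Here and below the sequences are
indexed from zero, so that `Y j` stands for `Y_{j+1}`. -/
def edge (Y : ℕ → ℝ) (n : ℕ) : ℝ := ∑ j ∈ Finset.range n, Y j + n

/-- `V(x) = ∑_{n ≥ 1} (-1)^{ε_n} X_n 1_{[L_n - 1, L_n]}(x)`, for one realisation. -/
def potentialIV (X Y : ℕ → ℝ) (ε : ℕ → ℕ) (x : ℝ) : ℝ :=
  ∑' n : ℕ, (Icc (edge Y (n + 1) - 1) (edge Y (n + 1))).indicator (fun _ => (-1) ^ ε n * X n) x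

/-- `X` has density `p` with respect to Lebesgue measure. -/
def HasDensity {Ω : Type*} [MeasurableSpace Ω] (P : Measure Ω) (X : Ω → ℝ) (p : ℝ → ℝ) : Prop :=
  P.map X = volume.withDensity fun x => ENNReal.ofReal (p x)

/-- The heights of Model II: i.i.d. with a bounded continuous density that is positive on `(0, ∞)`
and vanishes on `(-∞, 0]`. Nothing is assumed on the tails. -/
structure IsModelII {Ω : Type*} [MeasurableSpace Ω] (P : Measure Ω) (X : ℕ → Ω → ℝ)
    (p : ℝ → ℝ) : Prop where
  measurable : ∀ n, Measurable (X n)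
  indep : iIndepFun X P
  density : ∀ n, HasDensity P (X n) p
  continuous : Continuous p
  bounded : ∃ C, ∀ x, p x ≤ C
  pos : ∀ x, 0 < x → 0 < p x
  zero : ∀ x, x ≤ 0 → p x = 0

/-- The data of Model IV: heights `X` (with `√X_n` having density `p₁`), gaps `Y` (with density
`p₂`) and signs `ε`, each an i.i.d. sequence, the signs being fair and independent of the heights
and gaps. Nothing is assumed on the tails. -/
structure IsModelIV {Ω : Type*} [MeasurableSpace Ω] (P : Measure Ω) (X Y : ℕ → Ω → ℝ)
    (ε : ℕ → Ω → ℕ) (p₁ p₂ : ℝ → ℝ) : Prop where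
  measurable_X : ∀ n, Measurable (X n)
  measurable_Y : ∀ n, Measurable (Y n)
  measurable_sign : ∀ n, Measurable (ε n)
  nonneg_X : ∀ n, ∀ᵐ ω ∂P, 0 ≤ X n ω
  indep_X : iIndepFun X P
  indep_Y : iIndepFun Y P
  indep_sign : iIndepFun ε P
  indep_sign_rest : IndepFun (fun ω n => ε n ω) (fun ω n => (X n ω, Y n ω)) P
  density_X : ∀ n, HasDensity P (fun ω => √(X n ω)) p₁
  density_Y : ∀ n, HasDensity P (Y n) p₂
  sign_one : ∀ n, P {ω | ε n ω = 1} = 1 / 2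
  sign_zero : ∀ n, P {ω | ε n ω = 0} = 1 / 2
  measurable_p₁ : Measurable p₁
  measurable_p₂ : Measurable p₂
  bounded_p₁ : ∃ C, ∀ x, p₁ x ≤ C
  bounded_p₂ : ∃ C, ∀ x, p₂ x ≤ C
  pos_p₁ : ∀ x, 0 < x → 0 < p₁ x
  pos_p₂ : ∀ x, 0 < x → 0 < p₂ x
  zero_p₁ : ∀ x, x < 0 → p₁ x = 0
  zero_p₂ : ∀ x, x < 0 → p₂ x = 0

end KronigPenny

end

/-! All that is needed of `V`, beyond local boundedness, is that `|V| ≤ 1` on unit intervals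
arbitrarily far out. Independence supplies these almost surely, by the second Borel-Cantelli lemma:
in Model II infinitely many heights lie in [-1, 1]; in Model IV infinitely many gaps, where the
potential vanishes, have length at least 1. Neither event involves θ₀, so one null set serves all
boundary conditions.

The deterministic criterion `isEssentiallySelfAdjoint_schrodinger` is a limit point argument. By
`adjoint_le_topologicalClosure` it suffices that the adjoint relation be symmetric. A pair (f, h) in
it solves -f'' + Vf = h weakly, and `exists_isSecondPrimitive_of_weak` turns f into a C¹ function
with the boundary condition. For two such pairs, Lagrange's identity expresses the defect of
symmetry as the limit of a Wronskian at infinity. On a good unit interval far out, f, h and hence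
f'' have small L¹ norm, so f and f' are small at some point
(`IsSecondPrimitive.exists_norm_wronskian_le`), and the limit is 0. -/

namespace KronigPenny

/-! ### Self-adjointness of the closure -/

section Abstract

variable {E : Type*} [NormedAddCommGroup E] [InnerProductSpace ℂ E]

/-- If the adjoint relation of a subspace is symmetric, it is contained in the closure. -/
theorem adjoint_le_topologicalClosure [CompleteSpace E] (G : Submodule ℂ (E × E))
    (h : ∀ p ∈ G.adjoint, ∀ q ∈ G.adjoint, inner ℂ p.2 q.1 = inner ℂ p.1 q.2) :
    G.adjoint ≤ G.topologicalClosure := by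
  intro x hx
  -- The sup norm on `E × E` is not Hilbertian; in the L² product the closure of a subspace is its
  -- double orthogonal complement.
  let e : WithLp 2 (E × E) ≃L[ℂ] E × E := WithLp.prodContinuousLinearEquiv 2 ℂ E E
  let K : Submodule ℂ (WithLp 2 (E × E)) := G.comap e.toLinearMap
  have hxK : e.symm x ∈ Kᗮᗮ := by
    rw [Submodule.mem_orthogonal]
    intro y hy
    rw [Submodule.mem_orthogonal] at hy
    -- A quarter turn carries the orthogonal complement of the graph into the adjoint relation.
    have hp : (y.snd, -y.fst) ∈ G.adjoint := by
      rw [Submodule.mem_adjoint_iff]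
      intro a b hab
      have := hy (WithLp.toLp 2 (a, b)) hab
      rw [WithLp.prod_inner_apply] at this
      simp only [inner_neg_right]
      change inner ℂ a y.fst + inner ℂ b y.snd = 0 at this
      linear_combination this
    have := h _ hp _ hx
    simp only [inner_neg_left] at this
    rw [WithLp.prod_inner_apply]
    change inner ℂ y.fst x.1 + inner ℂ y.snd x.2 = 0
    linear_combination -this
  rw [Submodule.orthogonal_orthogonal_eq_closure] at hxK
  have : e.symm x ∈ closure (e ⁻¹' (G : Set (E × E))) := hxK
  have h2 := e.continuous.closure_preimage_subset _ this
  exact (by simpa using h2 : x ∈ closure (G : Set (E × E)))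

theorem adjoint_topologicalClosure (G : Submodule ℂ (E × E)) :
    G.topologicalClosure.adjoint = G.adjoint := by
  ext x
  simp only [Submodule.mem_adjoint_iff]
  refine ⟨fun h a b hab => h a b (G.le_topologicalClosure hab), fun h a b hab => ?_⟩
  have hc : IsClosed {p : E × E | inner ℂ p.2 x.1 - inner ℂ p.1 x.2 = 0} :=
    isClosed_eq (by fun_prop) continuous_const
  exact closure_minimal (fun p hp => h p.1 p.2 hp) hc hab

/-- A graph and its closure have the same adjoint. Symmetry of `T` puts the closure inside that
adjoint, and symmetry of the adjoint gives the reverse inclusion. -/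
theorem isEssentiallySelfAdjoint_of_adjoint_symmetric [CompleteSpace E] (T : E →ₗ.[ℂ] E)
    (hT : Dense (T.domain : Set E)) (hs : T.IsFormalAdjoint T)
    (h : ∀ p ∈ T.graph.adjoint, ∀ q ∈ T.graph.adjoint, inner ℂ p.2 q.1 = inner ℂ p.1 q.2) :
    IsEssentiallySelfAdjoint T := by
  refine ⟨hT, hs, ?_⟩
  have hle : T ≤ T.adjoint := hs.le_adjoint hT
  have hcl : T.IsClosable := (LinearPMap.adjoint_isClosed hT).isClosable.leIsClosable hle
  have hd : Dense (T.closure.domain : Set E) := hT.mono T.le_closure.1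
  rw [LinearPMap.isSelfAdjoint_def]
  apply LinearPMap.eq_of_eq_graph
  rw [LinearPMap.adjoint_graph_eq_graph_adjoint hd, ← hcl.graph_closure_eq_closure_graph,
    adjoint_topologicalClosure]
  refine le_antisymm (adjoint_le_topologicalClosure _ h) ?_
  rw [← LinearPMap.adjoint_graph_eq_graph_adjoint hT]
  exact Submodule.topologicalClosure_minimal _ (LinearPMap.le_graph_of_le hle)
    (LinearPMap.adjoint_isClosed hT)

end Abstract

/-! ### Second primitives and their Wronskians -/

/-- Increments of the primitive of `u` are dominated by those of the primitive of `‖u‖`. -/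
theorem absolutelyContinuousOnInterval_intervalIntegral {u : ℝ → ℂ} {a b c : ℝ}
    (hu : IntervalIntegrable u volume a b) (hc : c ∈ uIcc a b) :
    AbsolutelyContinuousOnInterval (fun x => ∫ t in c..x, u t) a b := by
  have hn := hu.norm.absolutelyContinuousOnInterval_intervalIntegral hc
  unfold AbsolutelyContinuousOnInterval at hn ⊢
  refine squeeze_zero' (.of_forall fun _ => Finset.sum_nonneg fun i _ => dist_nonneg) ?_ hn
  rw [Filter.eventually_inf_principal]
  filter_upwards with I hI
  refine Finset.sum_le_sum fun i hi => ?_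
  obtain ⟨h1, h2⟩ := hI.1 i hi
  have key : ∀ x ∈ uIcc a b, ∀ y ∈ uIcc a b, IntervalIntegrable u volume x y := fun x hx y hy =>
    hu.mono_set (uIcc_subset_uIcc hx hy)
  rw [dist_comm, dist_comm (∫ t in c.._, ‖u t‖), dist_eq_norm, dist_eq_norm,
    intervalIntegral.integral_interval_sub_left (key _ hc _ h2) (key _ hc _ h1),
    intervalIntegral.integral_interval_sub_left (key _ hc _ h2).norm (key _ hc _ h1).norm]
  exact intervalIntegral.norm_integral_le_abs_integral_norm

theorem intervalIntegrable_of_locallyIntegrable {u : ℝ → ℂ} (hu : LocallyIntegrable u)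
    (a b : ℝ) : IntervalIntegrable u volume a b :=
  (hu.integrableOn_isCompact isCompact_uIcc).intervalIntegrable

/-- Product rule for primitives of integrable functions. -/
theorem primitive_mul_primitive {u v P Q : ℝ → ℂ} (hu : LocallyIntegrable u)
    (hv : LocallyIntegrable v) (hP : ∀ x, P x = P 0 + ∫ t in (0 : ℝ)..x, u t)
    (hQ : ∀ x, Q x = Q 0 + ∫ t in (0 : ℝ)..x, v t) (R : ℝ) :
    P R * Q R = P 0 * Q 0 + ∫ x in (0 : ℝ)..R, (u x * Q x + P x * v x) := by
  have ui : ∀ a b, IntervalIntegrable u volume a b := intervalIntegrable_of_locallyIntegrable hu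
  have vi : ∀ a b, IntervalIntegrable v volume a b := intervalIntegrable_of_locallyIntegrable hv
  have cP : Continuous P := by
    rw [funext hP]; exact continuous_const.add (intervalIntegral.continuous_primitive ui 0)
  have cQ : Continuous Q := by
    rw [funext hQ]; exact continuous_const.add (intervalIntegral.continuous_primitive vi 0)
  have wi : IntervalIntegrable (fun x => u x * Q x + P x * v x) volume 0 R :=
    ((ui 0 R).mul_continuousOn cQ.continuousOn).add ((vi 0 R).continuousOn_mul cP.continuousOn)
  have const : ∀ c : ℂ, AbsolutelyContinuousOnInterval (fun _ : ℝ => c) 0 R := fun c =>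
    ((LipschitzWith.const c).lipschitzOnWith).absolutelyContinuousOnInterval
  have aP : AbsolutelyContinuousOnInterval P 0 R := by
    rw [funext hP]
    exact (const _).fun_add (absolutelyContinuousOnInterval_intervalIntegral (ui 0 R) left_mem_uIcc)
  have aQ : AbsolutelyContinuousOnInterval Q 0 R := by
    rw [funext hQ]
    exact (const _).fun_add (absolutelyContinuousOnInterval_intervalIntegral (vi 0 R) left_mem_uIcc)
  have aW := absolutelyContinuousOnInterval_intervalIntegral wi left_mem_uIcc
  -- With `u`, `v` only locally integrable the product rule holds almost everywhere; absolute
  -- continuity upgrades a derivative zero a.e. to constancy.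
  obtain ⟨C, hC⟩ := ((aP.fun_smul aQ).fun_sub aW).const_of_ae_hasDerivAt_zero (by
    filter_upwards [(ui 0 R).ae_hasDerivAt_integral, (vi 0 R).ae_hasDerivAt_integral,
      wi.ae_hasDerivAt_integral] with x h1 h2 h3 hx
    have d1 : HasDerivAt P (u x) x := by
      rw [funext hP]; exact (h1 hx 0 left_mem_uIcc).const_add _
    have d2 : HasDerivAt Q (v x) x := by
      rw [funext hQ]; exact (h2 hx 0 left_mem_uIcc).const_add _
    have := (d1.mul d2).sub (h3 hx 0 left_mem_uIcc)
    rw [sub_self] at this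
    exact this)
  have h0 := hC 0 left_mem_uIcc
  have hR := hC R right_mem_uIcc
  simp only [smul_eq_mul, intervalIntegral.integral_same] at h0 hR
  linear_combination hR - h0

/-- `F` is continuously differentiable with derivative `F'`, a primitive of `w`. -/
structure IsSecondPrimitive (F F' w : ℝ → ℂ) : Prop where
  locallyIntegrable : LocallyIntegrable w
  hasDerivAt : ∀ x, HasDerivAt F (F' x) x
  deriv_eq : ∀ x, F' x = F' 0 + ∫ t in (0 : ℝ)..x, w t

namespace IsSecondPrimitive

variable {F F' w G G' v : ℝ → ℂ}

theorem intervalIntegrable (h : IsSecondPrimitive F F' w) (a b : ℝ) :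
    IntervalIntegrable w volume a b :=
  intervalIntegrable_of_locallyIntegrable h.locallyIntegrable a b

theorem continuous (h : IsSecondPrimitive F F' w) : Continuous F :=
  continuous_iff_continuousAt.2 fun x => (h.hasDerivAt x).continuousAt

theorem continuous_deriv (h : IsSecondPrimitive F F' w) : Continuous F' := by
  rw [funext h.deriv_eq]
  exact continuous_const.add
    (intervalIntegral.continuous_primitive h.intervalIntegrable 0)

theorem eq_add_integral (h : IsSecondPrimitive F F' w) (x : ℝ) :
    F x = F 0 + ∫ t in (0 : ℝ)..x, F' t := by
  rw [intervalIntegral.integral_eq_sub_of_hasDerivAt (fun t _ => h.hasDerivAt t)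
    (h.continuous_deriv.intervalIntegrable _ _)]
  ring

theorem of_contDiff {φ : ℝ → ℂ} (h : ContDiff ℝ (⊤ : ℕ∞) φ) :
    IsSecondPrimitive φ (deriv φ) (deriv (deriv φ)) := by
  have h1 := (contDiff_infty_iff_deriv.1 h).2
  have h2 := (contDiff_infty_iff_deriv.1 h1).2
  refine ⟨h2.continuous.locallyIntegrable,
    fun x => (h.differentiable (by simp) x).hasDerivAt, fun x => ?_⟩
  rw [intervalIntegral.integral_deriv_eq_sub (fun t _ => h1.differentiable (by simp) t)
    (h2.continuous.intervalIntegrable _ _)]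
  ring

/-- Lagrange's identity: two product rules are subtracted and the terms `F' G'` cancel. -/
theorem wronskian (h : IsSecondPrimitive F F' w) (k : IsSecondPrimitive G G' v) (R : ℝ) :
    F' R * G R - F R * G' R =
      F' 0 * G 0 - F 0 * G' 0 + ∫ x in (0 : ℝ)..R, (w x * G x - F x * v x) := by
  have e1 := primitive_mul_primitive h.locallyIntegrable k.continuous_deriv.locallyIntegrable
    h.deriv_eq k.eq_add_integral R
  have e2 := primitive_mul_primitive h.continuous_deriv.locallyIntegrable k.locallyIntegrable
    h.eq_add_integral k.deriv_eq R
  have i1 : IntervalIntegrable (fun x => w x * G x + F' x * G' x) volume 0 R :=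
    ((h.intervalIntegrable _ _).mul_continuousOn k.continuous.continuousOn).add
      ((h.continuous_deriv.mul k.continuous_deriv).intervalIntegrable _ _)
  have i2 : IntervalIntegrable (fun x => F' x * G' x + F x * v x) volume 0 R :=
    ((h.continuous_deriv.mul k.continuous_deriv).intervalIntegrable _ _).add
      ((k.intervalIntegrable _ _).continuousOn_mul h.continuous.continuousOn)
  have e3 : ∫ x in (0 : ℝ)..R, (w x * G x - F x * v x) =
      (∫ x in (0 : ℝ)..R, (w x * G x + F' x * G' x)) -
        ∫ x in (0 : ℝ)..R, (F' x * G' x + F x * v x) := by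
    rw [← intervalIntegral.integral_sub i1 i2]
    congr 1; funext x; ring
  rw [e1, e2, e3]; ring

/-- On an interval the derivative is controlled by the function and its second derivative. -/
theorem norm_deriv_le (h : IsSecondPrimitive F F' w) {a x y : ℝ} (hx : x ∈ Ioo a (a + 1 / 3))
    (hy : y ∈ Ioo (a + 2 / 3) (a + 1)) :
    ‖F' x‖ ≤ 3 * (‖F x‖ + ‖F y‖ + ∫ t in a..(a + 1), ‖w t‖) := by
  obtain ⟨hx1, hx2⟩ := hx
  obtain ⟨hy1, hy2⟩ := hy
  have hxy : x ≤ y := by linarith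
  set K := ∫ t in a..(a + 1), ‖w t‖ with hK
  have hi := h.intervalIntegrable
  have hK0 : 0 ≤ K := intervalIntegral.integral_nonneg (by linarith) fun t _ => norm_nonneg _
  have bound : ∀ s ∈ Icc x y, ‖F' s - F' x‖ ≤ K := by
    intro s hs
    have : F' s - F' x = ∫ t in x..s, w t := by
      rw [h.deriv_eq s, h.deriv_eq x, add_sub_add_left_eq_sub,
        intervalIntegral.integral_interval_sub_left (hi _ _) (hi _ _)]
    rw [this]
    refine (intervalIntegral.norm_integral_le_integral_norm hs.1).trans ?_
    exact intervalIntegral.integral_mono_interval hx1.le hs.1 (by linarith [hs.2])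
      (.of_forall fun t => norm_nonneg _) (hi _ _).norm
  -- Removing the linear part `s F'(x)` leaves a function whose derivative `F' s - F' x` is at most
  -- `K` in norm.
  have mv := (convex_Icc x y).norm_image_sub_le_of_norm_hasDerivWithin_le
    (f := fun s => F s - (s : ℂ) * F' x) (f' := fun s => F' s - F' x) (C := K)
    (fun s _ => by
      have := (h.hasDerivAt s).sub ((Complex.ofRealCLM.hasDerivAt (x := s)).mul_const (F' x))
      rw [Complex.ofRealCLM_apply, Complex.ofReal_one, one_mul] at this
      exact this.hasDerivWithinAt) bound (left_mem_Icc.2 hxy) (right_mem_Icc.2 hxy)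
  have e : ((y - x : ℝ) : ℂ) * F' x =
      F y - F x - ((F y - (y : ℂ) * F' x) - (F x - (x : ℂ) * F' x)) := by push_cast; ring
  have n1 : (y - x) * ‖F' x‖ = ‖((y - x : ℝ) : ℂ) * F' x‖ := by
    rw [norm_mul, Complex.norm_real, Real.norm_of_nonneg (by linarith)]
  have n2 : (y - x) * ‖F' x‖ ≤ ‖F y‖ + ‖F x‖ + K * (y - x) := by
    rw [n1, e]
    refine (norm_sub_le _ _).trans (add_le_add (norm_sub_le _ _) (mv.trans_eq ?_))
    rw [Real.norm_of_nonneg (by linarith)]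
  -- Here 1/3 < y - x < 1: the lower bound produces the factor 3, the upper one absorbs `K * (y -
  -- x)`.
  nlinarith [norm_nonneg (F' x), norm_nonneg (F x), norm_nonneg (F y)]

end IsSecondPrimitive

/-! ### Weak solutions on the half line -/

theorem integral_halfLine_eq {g : ℝ → ℂ} {M : ℝ} (hM : 0 ≤ M) (hg : ∀ x, M ≤ x → g x = 0) :
    ∫ x, g x ∂halfLine = ∫ x in (0 : ℝ)..M, g x := by
  rw [halfLine, integral_Ici_eq_integral_Ioi, intervalIntegral.integral_of_le hM]
  refine (setIntegral_eq_of_subset_of_forall_sdiff_eq_zero measurableSet_Ioi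
    Ioc_subset_Ioi_self fun x hx => hg x ?_)
  by_contra hlt
  exact hx.2 ⟨hx.1, (not_le.1 hlt).le⟩

theorem contDiff_primitive {ψ : ℝ → ℂ} (h : ContDiff ℝ (⊤ : ℕ∞) ψ) (M : ℝ) :
    ContDiff ℝ (⊤ : ℕ∞) fun x => ∫ t in M..x, ψ t := by
  have hd : ∀ x, HasDerivAt (fun x => ∫ t in M..x, ψ t) (ψ x) x := fun x =>
    (h.continuous.integral_hasStrictDerivAt M x).hasDerivAt
  refine contDiff_infty_iff_deriv.2 ⟨fun x => (hd x).differentiableAt, ?_⟩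
  rwa [funext fun x => (hd x).deriv]

theorem deriv_primitive {ψ : ℝ → ℂ} (h : ContDiff ℝ (⊤ : ℕ∞) ψ) (M : ℝ) :
    deriv (fun x => ∫ t in M..x, ψ t) = ψ :=
  funext fun x => (h.continuous.integral_hasStrictDerivAt M x).hasDerivAt.deriv

/-- The affine function satisfying the boundary condition. -/
noncomputable def boundaryAffine (θ : ℝ) (x : ℝ) : ℂ := (x : ℂ) * (Real.cos θ : ℂ) + (Real.sin θ : ℂ)

theorem isSecondPrimitive_boundaryAffine (θ : ℝ) :
    IsSecondPrimitive (boundaryAffine θ) (fun _ => (Real.cos θ : ℂ)) 0 where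
  locallyIntegrable := locallyIntegrable_zero
  hasDerivAt x := by
    have := ((Complex.ofRealCLM.hasDerivAt (x := x)).mul_const (Real.cos θ : ℂ)).add_const
      (Real.sin θ : ℂ)
    rw [Complex.ofRealCLM_apply, Complex.ofReal_one, one_mul] at this
    exact this
  deriv_eq x := by simp

/-- Every source orthogonal to `boundaryAffine θ` is the second derivative of a test function. -/
theorem exists_isTest_deriv_deriv_eq {θ : ℝ} {ψ : ℝ → ℂ} (h : ContDiff ℝ (⊤ : ℕ∞) ψ)
    (hc : HasCompactSupport ψ) (h0 : ∫ x, ψ x * boundaryAffine θ x ∂halfLine = 0) :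
    ∃ φ, IsTest θ φ ∧ ∀ x, 0 ≤ x → deriv (deriv φ) x = ψ x := by
  -- Both primitives are taken from a point `M` past the support, so they vanish to its right.
  obtain ⟨M, hM, hψ⟩ := hc.exists_pos_le_norm
  have hψM : ∀ x, M ≤ x → ψ x = 0 := fun x hx => hψ x (hx.trans (le_abs_self x))
  set φ₁ : ℝ → ℂ := fun x => ∫ t in M..x, ψ t with hφ₁
  have s₁ : ContDiff ℝ (⊤ : ℕ∞) φ₁ := contDiff_primitive h M
  set φ₀ : ℝ → ℂ := fun x => ∫ t in M..x, φ₁ t with hφ₀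
  have s₀ : ContDiff ℝ (⊤ : ℕ∞) φ₀ := contDiff_primitive s₁ M
  have d₁ : deriv φ₁ = ψ := deriv_primitive h M
  have d₀ : deriv φ₀ = φ₁ := deriv_primitive s₁ M
  have z₁ : ∀ x, M ≤ x → φ₁ x = 0 := fun x hx => by
    rw [hφ₁]
    refine intervalIntegral.integral_zero_ae (.of_forall fun t ht => hψM t ?_)
    rw [uIoc_of_le hx] at ht; exact ht.1.le
  have z₀ : ∀ x, M ≤ x → φ₀ x = 0 := fun x hx => by
    rw [hφ₀]
    refine intervalIntegral.integral_zero_ae (.of_forall fun t ht => z₁ t ?_)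
    rw [uIoc_of_le hx] at ht; exact ht.1.le
  -- To the left of the support `φ₀` is affine and need not vanish. The cutoff is 1 on a
  -- neighbourhood of [0, ∞), so it changes no derivative there.
  set χ : ℝ → ℂ := fun x => (Real.smoothTransition (x + 2) : ℂ) with hχ
  have sχ : ContDiff ℝ (⊤ : ℕ∞) χ :=
    Complex.ofRealCLM.contDiff.comp (Real.smoothTransition.contDiff.comp (by fun_prop))
  have eq0 : EqOn (χ * φ₀) φ₀ (Ioi (-1)) := fun x hx => by
    have : Real.smoothTransition (x + 2) = 1 :=
      Real.smoothTransition.one_of_one_le (by linarith [mem_Ioi.1 hx])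
    simp [hχ, this]
  have eq1 : EqOn (deriv (χ * φ₀)) φ₁ (Ioi (-1)) := fun x hx => by
    rw [(eq0.eventuallyEq_of_mem (isOpen_Ioi.mem_nhds hx)).deriv_eq, d₀]
  have eq2 : EqOn (deriv (deriv (χ * φ₀))) ψ (Ioi (-1)) := fun x hx => by
    rw [(eq1.eventuallyEq_of_mem (isOpen_Ioi.mem_nhds hx)).deriv_eq, d₁]
  refine ⟨χ * φ₀, ⟨sχ.mul s₀, ?_, ?_⟩, fun x hx => eq2 (by simp; linarith)⟩
  · refine HasCompactSupport.intro (isCompact_Icc (a := -2) (b := M)) fun x hx => ?_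
    rcases not_and_or.1 hx with hx | hx
    · have : Real.smoothTransition (x + 2) = 0 :=
        Real.smoothTransition.zero_of_nonpos (by linarith)
      simp [hχ, this]
    · rw [Pi.mul_apply, z₀ x (not_le.1 hx).le, mul_zero]
  · rw [eq0 (by simp), eq1 (by simp)]
    -- Lagrange's identity against `boundaryAffine θ`, whose data at 0 are (sin θ, cos θ), turns the
    -- orthogonality `h0` into the boundary condition.
    have p := IsSecondPrimitive.of_contDiff s₀
    rw [d₀, d₁] at p
    have W := p.wronskian (isSecondPrimitive_boundaryAffine θ) M
    rw [z₁ M le_rfl, z₀ M le_rfl] at W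
    simp only [Pi.zero_apply, mul_zero, zero_mul, sub_zero] at W
    rw [← integral_halfLine_eq hM.le (fun x hx => by rw [hψM x hx, zero_mul]), h0] at W
    simp only [boundaryAffine, Complex.ofReal_zero, zero_mul, zero_add] at W
    linear_combination W

/-- Measurable potentials that are bounded on bounded parts of the half line. -/
structure IsLocallyBounded (V : ℝ → ℝ) : Prop where
  measurable : Measurable V
  bounded : ∀ R, ∃ C, ∀ x ∈ Icc 0 R, |V x| ≤ C

theorem IsLocallyBounded.locallyIntegrable_mul {V : ℝ → ℝ} (hV : IsLocallyBounded V)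
    {f : ℝ → ℂ} (hf : LocallyIntegrable f halfLine) :
    LocallyIntegrable (fun x => (V x : ℂ) * f x) halfLine := by
  rw [locallyIntegrable_iff] at hf ⊢
  intro K hK
  obtain ⟨R, hR⟩ := hK.isBounded.subset_closedBall 0
  obtain ⟨C, hC⟩ := hV.bounded R
  refine (hf K hK).bdd_mul (c := C) (Complex.measurable_ofReal.comp hV.measurable).aestronglyMeasurable
    ?_
  rw [halfLine, Measure.restrict_restrict hK.measurableSet]
  filter_upwards [ae_restrict_mem (hK.measurableSet.inter measurableSet_Ici)] with x hx
  rw [Complex.norm_real]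
  refine hC x ⟨hx.2, ?_⟩
  have := hR hx.1
  rw [mem_closedBall_zero_iff] at this
  exact (le_abs_self x).trans this

theorem locallyIntegrable_indicator_Ici {u : ℝ → ℂ} (hu : LocallyIntegrable u halfLine) :
    LocallyIntegrable ((Ici (0 : ℝ)).indicator u) := by
  rw [locallyIntegrable_iff] at hu ⊢
  intro K hK
  have := hu K hK
  rw [IntegrableOn, halfLine, Measure.restrict_restrict hK.measurableSet, inter_comm] at this
  rw [IntegrableOn, integrable_indicator_iff measurableSet_Ici, IntegrableOn,
    Measure.restrict_restrict measurableSet_Ici]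
  exact this

theorem integrable_mul_of_hasCompactSupport {u φ : ℝ → ℂ} (hu : LocallyIntegrable u halfLine)
    (hφ : Continuous φ) (hc : HasCompactSupport φ) :
    Integrable (fun x => u x * φ x) halfLine :=
  hu.integrable_smul_right_of_hasCompactSupport hφ hc

theorem exists_isSecondPrimitive {w : ℝ → ℂ} (hw : LocallyIntegrable w) :
    ∃ G G', IsSecondPrimitive G G' w ∧ G 0 = 0 ∧ G' 0 = 0 := by
  have hi := intervalIntegrable_of_locallyIntegrable hw
  have hc : Continuous fun x => ∫ t in (0 : ℝ)..x, w t := intervalIntegral.continuous_primitive hi 0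
  refine ⟨fun x => ∫ s in (0 : ℝ)..x, ∫ t in (0 : ℝ)..s, w t, fun x => ∫ t in (0 : ℝ)..x, w t,
    ⟨hw, fun x => (hc.integral_hasStrictDerivAt 0 x).hasDerivAt, fun x => by simp⟩, by simp, by simp⟩

/-- Provides the function by which any test function is corrected to be orthogonal to
`boundaryAffine θ`. -/
theorem exists_integral_mul_boundaryAffine_ne_zero (θ : ℝ) :
    ∃ g : ℝ → ℝ, ContDiff ℝ (⊤ : ℕ∞) g ∧ HasCompactSupport g ∧
      ∫ x, (g x : ℂ) * boundaryAffine θ x ∂halfLine ≠ 0 := by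
  by_contra! H
  have hb := isSecondPrimitive_boundaryAffine θ
  have h0 : boundaryAffine θ =ᵐ[halfLine] 0 :=
    ae_eq_zero_of_integral_contDiff_smul_eq_zero hb.continuous.locallyIntegrable
      fun g hg hc => by simpa using H g hg hc
  have hE : EqOn (boundaryAffine θ) 0 (Ioi 0) :=
    Measure.eqOn_open_of_ae_eq (ae_restrict_of_ae_restrict_of_subset Ioi_subset_Ici_self h0)
      isOpen_Ioi hb.continuous.continuousOn continuousOn_const
  have h1 := hE (show (1 : ℝ) ∈ Ioi 0 by simp)
  have h2 := hE (show (2 : ℝ) ∈ Ioi 0 by simp)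
  simp only [boundaryAffine, Pi.zero_apply] at h1 h2
  norm_cast at h1 h2
  have hc : Real.cos θ = 0 := by linarith
  have hs : Real.sin θ = 0 := by linarith
  have := Real.sin_sq_add_cos_sq θ
  simp [hc, hs] at this

/-- Weak solutions of `-f'' + V f = h` with the boundary condition are classical solutions. -/
theorem exists_isSecondPrimitive_of_weak {V : ℝ → ℝ} (hV : IsLocallyBounded V) {θ : ℝ}
    {f h : ℝ → ℂ} (hf : LocallyIntegrable f halfLine) (hh : LocallyIntegrable h halfLine)
    (weak : ∀ φ, IsTest θ φ → ∫ x, f x * expr V φ x ∂halfLine = ∫ x, h x * φ x ∂halfLine) :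
    ∃ F F' w, IsSecondPrimitive F F' w ∧ F =ᵐ[halfLine] f ∧
      w =ᵐ[halfLine] (fun x => (V x : ℂ) * f x - h x) ∧
      F 0 * (Real.cos θ : ℂ) - F' 0 * (Real.sin θ : ℂ) = 0 := by
  have hu : LocallyIntegrable (fun x => (V x : ℂ) * f x - h x) halfLine :=
    (hV.locallyIntegrable_mul hf).sub hh
  have hw := locallyIntegrable_indicator_Ici hu
  set w := (Ici (0 : ℝ)).indicator fun x => (V x : ℂ) * f x - h x with hwdef
  have hwae : w =ᵐ[halfLine] (fun x => (V x : ℂ) * f x - h x) :=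
    indicator_ae_eq_restrict measurableSet_Ici
  -- `G` solves the equation G'' = w with zero data at 0; as in du Bois-Reymond's lemma, `f - G`
  -- will be a multiple of `boundaryAffine θ`.
  obtain ⟨G, G', hG, G0, G'0⟩ := exists_isSecondPrimitive hw
  have hb := isSecondPrimitive_boundaryAffine θ
  have hGl : LocallyIntegrable G halfLine := hG.continuous.locallyIntegrable
  have hbl : LocallyIntegrable (boundaryAffine θ) halfLine := hb.continuous.locallyIntegrable
  have hd : LocallyIntegrable (fun x => f x - G x) halfLine := hf.sub hGl
  have orth : ∀ ψ : ℝ → ℂ, ContDiff ℝ (⊤ : ℕ∞) ψ → HasCompactSupport ψ →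
      ∫ x, ψ x * boundaryAffine θ x ∂halfLine = 0 → ∫ x, (f x - G x) * ψ x ∂halfLine = 0 := by
    intro ψ hψ hψc h0
    obtain ⟨φ, hφ, hφ2⟩ := exists_isTest_deriv_deriv_eq hψ hψc h0
    have i1 := integrable_mul_of_hasCompactSupport hf hψ.continuous hψc
    have i2 := integrable_mul_of_hasCompactSupport hu hφ.smooth.continuous hφ.compact
    have i3 := integrable_mul_of_hasCompactSupport hh hφ.smooth.continuous hφ.compact
    have i23 : Integrable (fun x => ((V x : ℂ) * f x - h x) * φ x + h x * φ x) halfLine :=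
      i2.add i3
    have i4 := integrable_mul_of_hasCompactSupport hGl hψ.continuous hψc
    have e1 : ∫ x, f x * expr V φ x ∂halfLine =
        ∫ x, (((V x : ℂ) * f x - h x) * φ x + h x * φ x - f x * ψ x) ∂halfLine := by
      refine integral_congr_ae ?_
      filter_upwards [ae_restrict_mem measurableSet_Ici] with x hx
      rw [expr, hφ2 x hx]; ring
    have e2 := weak φ hφ
    rw [e1, integral_sub i23 i1, integral_add i2 i3] at e2
    obtain ⟨M₁, hM₁, z₁⟩ := hφ.compact.exists_pos_le_norm
    obtain ⟨M₂, hM₂, z₂⟩ := hψc.exists_pos_le_norm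
    -- The extra 1 makes `φ` vanish on a neighbourhood of `M`, so that its derivative vanishes there
    -- too.
    set M := max (M₁ + 1) M₂ with hM
    have hM0 : 0 ≤ M := by positivity
    have a1 : ∀ x, M₁ ≤ x → φ x = 0 := fun x hx => z₁ x (hx.trans (le_abs_self x))
    have a2 : ∀ x, M ≤ x → ψ x = 0 := fun x hx =>
      z₂ x (((le_max_right _ _).trans hx).trans (le_abs_self x))
    have hM1 : M₁ + 1 ≤ M := le_max_left _ _
    have a3 : deriv φ M = 0 := by
      have : φ =ᶠ[nhds M] fun _ => 0 := by
        filter_upwards [Ioi_mem_nhds (show M₁ < M by linarith)] with x hx using a1 x (le_of_lt hx)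
      rw [this.deriv_eq, deriv_const]
    have W := (IsSecondPrimitive.of_contDiff hφ.smooth).wronskian hG M
    rw [a1 M (by linarith), a3, G0, G'0] at W
    have e3 : ∫ x in (0 : ℝ)..M, (deriv (deriv φ) x * G x - φ x * w x) =
        ∫ x, (G x * ψ x - ((V x : ℂ) * f x - h x) * φ x) ∂halfLine := by
      rw [integral_halfLine_eq hM0 (fun x hx => by rw [a1 x (by linarith), a2 x hx]; ring)]
      refine intervalIntegral.integral_congr fun x hx => ?_
      rw [uIcc_of_le hM0] at hx
      have : w x = (V x : ℂ) * f x - h x := indicator_of_mem (mem_Ici.2 hx.1) _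
      simp only [hφ2 x hx.1, this]; ring
    rw [e3, integral_sub i4 i2] at W
    have e4 : ∫ x, (f x - G x) * ψ x ∂halfLine =
        ∫ x, f x * ψ x ∂halfLine - ∫ x, G x * ψ x ∂halfLine := by
      rw [← integral_sub i1 i4]
      simp only [sub_mul]
    rw [e4]
    linear_combination -e2 + W
  obtain ⟨g₀, s₀, c₀, k₀⟩ := exists_integral_mul_boundaryAffine_ne_zero θ
  set k := ∫ x, (g₀ x : ℂ) * boundaryAffine θ x ∂halfLine with hk
  have cplx : ∀ g : ℝ → ℝ, ContDiff ℝ (⊤ : ℕ∞) g → HasCompactSupport g →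
      ContDiff ℝ (⊤ : ℕ∞) (fun x => (g x : ℂ)) ∧ HasCompactSupport (fun x => (g x : ℂ)) :=
    fun g hg hgc => ⟨Complex.ofRealCLM.contDiff.comp hg, hgc.comp_left Complex.ofReal_zero⟩
  obtain ⟨t₀, u₀⟩ := cplx g₀ s₀ c₀
  set c := (∫ x, (f x - G x) * (g₀ x : ℂ) ∂halfLine) / k with hcdef
  have main : ∀ᵐ x ∂halfLine, f x - G x - c * boundaryAffine θ x = 0 := by
    refine ae_eq_zero_of_integral_contDiff_smul_eq_zero
      (hd.sub (hb.continuous.const_mul c |>.locallyIntegrable)) fun g hg hgc => ?_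
    obtain ⟨t, u⟩ := cplx g hg hgc
    set l := ∫ x, (g x : ℂ) * boundaryAffine θ x ∂halfLine with hl
    have j1 := integrable_mul_of_hasCompactSupport hd t.continuous u
    have j2 := integrable_mul_of_hasCompactSupport hbl t.continuous u
    have j3 := integrable_mul_of_hasCompactSupport hd t₀.continuous u₀
    have j4 := integrable_mul_of_hasCompactSupport hbl t₀.continuous u₀
    have hl' : l = ∫ x, boundaryAffine θ x * (g x : ℂ) ∂halfLine := by simp only [hl, mul_comm]
    have hk' : k = ∫ x, boundaryAffine θ x * (g₀ x : ℂ) ∂halfLine := by simp only [hk, mul_comm]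
    -- The multiple of `g₀` makes the source orthogonal to `boundaryAffine θ`, as `orth` requires.
    have o := orth (fun x => (g x : ℂ) - l / k * (g₀ x : ℂ)) (t.sub (contDiff_const.mul t₀))
      (u.sub (u₀.mul_left)) (by
        have : ∀ x, ((g x : ℂ) - l / k * (g₀ x : ℂ)) * boundaryAffine θ x =
          boundaryAffine θ x * (g x : ℂ) - l / k * (boundaryAffine θ x * (g₀ x : ℂ)) :=
          fun x => by ring
        simp only [this]
        rw [integral_sub j2 (j4.const_mul _), integral_const_mul, ← hl', ← hk',
          div_mul_cancel₀ _ k₀, sub_self])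
    have e5 : ∀ x, (f x - G x) * ((g x : ℂ) - l / k * (g₀ x : ℂ)) =
        (f x - G x) * (g x : ℂ) - l / k * ((f x - G x) * (g₀ x : ℂ)) := fun x => by ring
    simp only [e5] at o
    rw [integral_sub j1 (j3.const_mul _), integral_const_mul] at o
    have e6 : ∀ x, g x • (f x - G x - c * boundaryAffine θ x) =
        (f x - G x) * (g x : ℂ) - c * (boundaryAffine θ x * (g x : ℂ)) := fun x => by
      rw [Complex.real_smul]; ring
    simp only [e6]
    rw [integral_sub j1 (j2.const_mul _), integral_const_mul, ← hl', hcdef]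
    linear_combination o
  refine ⟨fun x => G x + c * boundaryAffine θ x, fun x => G' x + c * (Real.cos θ : ℂ), w,
    ⟨hw, fun x => (hG.hasDerivAt x).add ((hb.hasDerivAt x).const_mul c), fun x => ?_⟩, ?_, hwae, ?_⟩
  · rw [hG.deriv_eq x]; ring
  · filter_upwards [main] with x hx
    linear_combination -hx
  · simp only [G0, G'0, boundaryAffine, Complex.ofReal_zero]; ring

/-! ### The Wronskian at infinity -/

open Filter Topology

theorem tendsto_integral_unit_interval {g : ℝ → ℝ} (hg : Integrable g halfLine) :
    Tendsto (fun a => ∫ t in a..(a + 1), g t) atTop (𝓝 0) := by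
  have hI : IntegrableOn g (Ioi 0) := IntegrableOn.mono_set hg Ioi_subset_Ici_self
  have h1 := intervalIntegral_tendsto_integral_Ioi 0 hI tendsto_id
  have h2 := intervalIntegral_tendsto_integral_Ioi 0 hI (tendsto_atTop_add_const_right atTop 1 tendsto_id)
  have h3 := h2.sub h1
  rw [sub_self] at h3
  refine h3.congr' ?_
  filter_upwards [eventually_ge_atTop 0] with a ha
  have hi : ∀ b, 0 ≤ b → IntervalIntegrable g volume 0 b := fun b hb =>
    (intervalIntegrable_iff_integrableOn_Ioc_of_le hb).2 (hI.mono_set Ioc_subset_Ioi_self)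
  exact intervalIntegral.integral_interval_sub_left (hi _ (by simp; linarith)) (hi _ ha)

theorem intervalIntegrable_of_locallyIntegrable_halfLine {f : ℝ → ℂ}
    (hf : LocallyIntegrable f halfLine) {a b : ℝ} (ha : 0 ≤ a) (hab : a ≤ b) :
    IntervalIntegrable f volume a b := by
  rw [intervalIntegrable_iff_integrableOn_Ioc_of_le hab]
  have := (hf.integrableOn_isCompact (isCompact_Icc (a := a) (b := b))).mono_set Ioc_subset_Icc_self
  rwa [IntegrableOn, halfLine, Measure.restrict_restrict measurableSet_Ioc,
    inter_eq_left.2 (show Ioc a b ⊆ Ici 0 from fun x hx => ha.trans hx.1.le)] at this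

theorem ae_uIoc_of_ae_halfLine {P : ℝ → Prop} (hP : ∀ᵐ x ∂halfLine, P x) {a b : ℝ} (ha : 0 ≤ a)
    (hab : a ≤ b) : ∀ᵐ x, x ∈ uIoc a b → P x := by
  rw [ae_restrict_iff' measurableSet_Ici] at hP
  filter_upwards [hP] with x hx hxR
  rw [uIoc_of_le hab] at hxR
  exact hx (ha.trans hxR.1.le)

theorem tendsto_integral_norm_unit_interval {f : ℝ → ℂ} (hf : MemLp f 2 halfLine) :
    Tendsto (fun a => ∫ t in a..(a + 1), ‖f t‖) atTop (𝓝 0) := by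
  have hsq : Integrable (fun x => ‖f x‖ ^ 2) halfLine := hf.integrable_norm_pow (by norm_num)
  have hl := hf.locallyIntegrable (by norm_num)
  have lim := tendsto_integral_unit_interval hsq
  rw [Metric.tendsto_atTop] at lim ⊢
  intro ε hε
  obtain ⟨N, hN⟩ := lim (ε ^ 2 / 4) (by positivity)
  refine ⟨max N 0, fun a ha => ?_⟩
  have ha0 : 0 ≤ a := (le_max_right _ _).trans ha
  have h1 := hN a ((le_max_left _ _).trans ha)
  have hab : a ≤ a + 1 := by linarith
  have hsub : Ioc a (a + 1) ⊆ Ici 0 := fun x hx => ha0.trans hx.1.le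
  have i1 := (intervalIntegrable_of_locallyIntegrable_halfLine hl ha0 hab).norm
  have i2 : IntervalIntegrable (fun x => ‖f x‖ ^ 2) volume a (a + 1) := by
    rw [intervalIntegrable_iff_integrableOn_Ioc_of_le hab]
    exact IntegrableOn.mono_set hsq hsub
  have n1 : 0 ≤ ∫ t in a..(a + 1), ‖f t‖ :=
    intervalIntegral.integral_nonneg hab fun _ _ => norm_nonneg _
  have n2 : 0 ≤ ∫ t in a..(a + 1), ‖f t‖ ^ 2 :=
    intervalIntegral.integral_nonneg hab fun _ _ => by positivity
  rw [Real.dist_0_eq_abs, abs_of_nonneg] at h1 ⊢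
  -- Weighted AM-GM in place of Cauchy-Schwarz: each of the two terms contributes at most ε/4.
  · have key : ∫ t in a..(a + 1), ‖f t‖ ≤ ∫ t in a..(a + 1), (ε / 4 + ε⁻¹ * ‖f t‖ ^ 2) := by
      refine intervalIntegral.integral_mono_on hab i1 (intervalIntegrable_const.add
        (i2.const_mul _)) fun t _ => ?_
      have : 0 ≤ ε⁻¹ * (‖f t‖ - ε / 2) ^ 2 := by positivity
      have e : ε⁻¹ * (‖f t‖ - ε / 2) ^ 2 = ε⁻¹ * ‖f t‖ ^ 2 - ‖f t‖ + ε / 4 := by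
        field_simp; ring
      linarith
    rw [intervalIntegral.integral_add intervalIntegrable_const (i2.const_mul _),
      intervalIntegral.integral_const, intervalIntegral.integral_const_mul] at key
    have : ε⁻¹ * ∫ t in a..(a + 1), ‖f t‖ ^ 2 < ε⁻¹ * (ε ^ 2 / 4) := by gcongr
    have e : ε⁻¹ * (ε ^ 2 / 4) = ε / 4 := by field_simp
    rw [add_sub_cancel_left, one_smul] at key
    linarith
  · exact n1
  · exact n2

/-- Some value does not exceed the mean over an interval of length 1/3, whence the factor 3. -/
theorem exists_le_three_mul_integral {g : ℝ → ℝ} (hg : Continuous g) (h0 : ∀ x, 0 ≤ g x)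
    {a b : ℝ} (hab : a ≤ b) (hb : b + 1 / 3 ≤ a + 1) :
    ∃ x ∈ Ioo b (b + 1 / 3), g x ≤ 3 * ∫ t in a..(a + 1), g t := by
  have hi : ∀ c d, IntervalIntegrable g volume c d := fun c d => hg.intervalIntegrable c d
  obtain ⟨x, hx, hle⟩ := exists_le_setAverage (μ := volume) (s := Ioo b (b + 1 / 3)) (f := g)
    (by simp) (by simp) (hg.integrableOn_Icc.mono_set Ioo_subset_Icc_self)
  refine ⟨x, hx, hle.trans ?_⟩
  rw [setAverage_eq, ← integral_Ioc_eq_integral_Ioo, ← intervalIntegral.integral_of_le (by linarith)]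
  have : volume.real (Ioo b (b + 1 / 3)) = 1 / 3 := by
    rw [Real.volume_real_Ioo_of_le (by linarith)]; ring
  rw [this, smul_eq_mul]
  have : ∫ t in b..(b + 1 / 3), g t ≤ ∫ t in a..(a + 1), g t :=
    intervalIntegral.integral_mono_interval hab (by linarith) hb (.of_forall h0) (hi _ _)
  linarith

/-- Points in the first and last thirds where both functions are at most `3 * m` control the
derivatives at the first point through `norm_deriv_le`. -/
theorem IsSecondPrimitive.exists_norm_wronskian_le {F₁ F₁' w₁ F₂ F₂' w₂ : ℝ → ℂ}
    (p₁ : IsSecondPrimitive F₁ F₁' w₁) (p₂ : IsSecondPrimitive F₂ F₂' w₂) {a m : ℝ}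
    (hF : ∫ t in a..(a + 1), (‖F₁ t‖ + ‖F₂ t‖) ≤ m) (hw₁ : ∫ t in a..(a + 1), ‖w₁ t‖ ≤ m)
    (hw₂ : ∫ t in a..(a + 1), ‖w₂ t‖ ≤ m) :
    ∃ x, a ≤ x ∧ ‖F₁' x * F₂ x - F₁ x * F₂' x‖ ≤ 126 * m ^ 2 := by
  have hc : Continuous fun t => ‖F₁ t‖ + ‖F₂ t‖ := p₁.continuous.norm.add p₂.continuous.norm
  have h0 : ∀ t, 0 ≤ ‖F₁ t‖ + ‖F₂ t‖ := fun t => by positivity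
  obtain ⟨x, hx, hxm⟩ := exists_le_three_mul_integral hc h0 (le_refl a) (by linarith)
  obtain ⟨y, hy, hym⟩ := exists_le_three_mul_integral hc h0 (a := a) (b := a + 2 / 3)
    (by linarith) (by linarith)
  have hy' : y ∈ Ioo (a + 2 / 3) (a + 1) := ⟨hy.1, by linarith [hy.2]⟩
  refine ⟨x, hx.1.le, ?_⟩
  have d₁ := p₁.norm_deriv_le hx hy'
  have d₂ := p₂.norm_deriv_le hx hy'
  have := norm_nonneg (F₁ x)
  have := norm_nonneg (F₂ x)
  have := norm_nonneg (F₁ y)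
  have := norm_nonneg (F₂ y)
  -- 21 = 3 (3 + 3 + 1): two function values and the integral of the second derivative.
  have b₁ : ‖F₁' x‖ ≤ 21 * m := by linarith
  have b₂ : ‖F₂' x‖ ≤ 21 * m := by linarith
  have hm : 0 ≤ m := (norm_nonneg _).trans b₁ |> fun h => by linarith
  calc ‖F₁' x * F₂ x - F₁ x * F₂' x‖ ≤ ‖F₁' x‖ * ‖F₂ x‖ + ‖F₁ x‖ * ‖F₂' x‖ := by
        rw [← norm_mul, ← norm_mul]; exact norm_sub_le _ _
    _ ≤ 21 * m * ‖F₂ x‖ + ‖F₁ x‖ * (21 * m) := by gcongr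
    _ = 21 * m * (‖F₁ x‖ + ‖F₂ x‖) := by ring
    _ ≤ 21 * m * (6 * m) := by gcongr; linarith
    _ = 126 * m ^ 2 := by ring

/-- Both vectors of data are orthogonal to the same nonzero vector (cos θ, -sin θ), so their
determinant vanishes. -/
theorem wronskian_eq_zero_of_boundary {θ : ℝ} {a a' b b' : ℂ}
    (ha : a * (Real.cos θ : ℂ) - a' * (Real.sin θ : ℂ) = 0)
    (hb : b * (Real.cos θ : ℂ) - b' * (Real.sin θ : ℂ) = 0) : a' * b - a * b' = 0 := by
  have h : (Real.sin θ : ℂ) ^ 2 + (Real.cos θ : ℂ) ^ 2 = 1 := by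
    exact_mod_cast Real.sin_sq_add_cos_sq θ
  linear_combination (-(a' * b - a * b')) * h +
    (-(Real.sin θ : ℂ) * b - (Real.cos θ : ℂ) * b') * ha +
    ((Real.sin θ : ℂ) * a + (Real.cos θ : ℂ) * a') * hb

/-- The bound on `V` enters here. It is asked on the open interval only, since in the models the
endpoints may belong to neighbouring bumps or cells. -/
theorem integral_norm_le_of_abs_le_one {V : ℝ → ℝ} {f h w : ℝ → ℂ} {a : ℝ} (ha0 : 0 ≤ a)
    (ha : ∀ x ∈ Ioo a (a + 1), |V x| ≤ 1) (hf : LocallyIntegrable f halfLine)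
    (hh : LocallyIntegrable h halfLine)
    (hw : w =ᵐ[halfLine] fun x => (V x : ℂ) * f x - h x) (hwl : LocallyIntegrable w) :
    ∫ t in a..(a + 1), ‖w t‖ ≤ (∫ t in a..(a + 1), ‖f t‖) + ∫ t in a..(a + 1), ‖h t‖ := by
  have hab : a ≤ a + 1 := by linarith
  have i1 := (intervalIntegrable_of_locallyIntegrable_halfLine hf ha0 hab).norm
  have i2 := (intervalIntegrable_of_locallyIntegrable_halfLine hh ha0 hab).norm
  rw [← intervalIntegral.integral_add i1 i2]
  refine intervalIntegral.integral_mono_ae_restrict hab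
    (intervalIntegrable_of_locallyIntegrable hwl _ _).norm (i1.add i2) ?_
  have hne : ∀ᵐ x : ℝ, x ≠ a + 1 := by simp [ae_iff]
  have hne' : ∀ᵐ x : ℝ, x ≠ a := by simp [ae_iff]
  rw [EventuallyLE, ae_restrict_iff' measurableSet_Icc]
  filter_upwards [ae_uIoc_of_ae_halfLine hw ha0 hab, hne, hne'] with x hx h1 h2 hxI
  have hI : x ∈ Ioo a (a + 1) := ⟨lt_of_le_of_ne hxI.1 h2.symm, lt_of_le_of_ne hxI.2 h1⟩
  rw [hx (by rw [uIoc_of_le hab]; exact Ioo_subset_Ioc_self hI)]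
  refine (norm_sub_le _ _).trans (add_le_add ?_ le_rfl)
  rw [norm_mul, Complex.norm_real]
  exact mul_le_of_le_one_left (norm_nonneg _) (ha x hI)

/-- Limit point property: weak solutions in `L²` have vanishing Wronskian at infinity. -/
theorem integral_mul_eq_of_weak {V : ℝ → ℝ} (hV : IsLocallyBounded V)
    (hb : ∀ N : ℝ, ∃ a ≥ N, ∀ x ∈ Ioo a (a + 1), |V x| ≤ 1) {θ : ℝ} {f₁ h₁ f₂ h₂ : ℝ → ℂ}
    (hf₁ : MemLp f₁ 2 halfLine) (hh₁ : MemLp h₁ 2 halfLine)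
    (hf₂ : MemLp f₂ 2 halfLine) (hh₂ : MemLp h₂ 2 halfLine)
    (weak₁ : ∀ φ, IsTest θ φ → ∫ x, f₁ x * expr V φ x ∂halfLine = ∫ x, h₁ x * φ x ∂halfLine)
    (weak₂ : ∀ φ, IsTest θ φ → ∫ x, f₂ x * expr V φ x ∂halfLine = ∫ x, h₂ x * φ x ∂halfLine) :
    ∫ x, h₁ x * f₂ x ∂halfLine = ∫ x, f₁ x * h₂ x ∂halfLine := by
  have loc : ∀ {g : ℝ → ℂ}, MemLp g 2 halfLine → LocallyIntegrable g halfLine := fun hg =>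
    hg.locallyIntegrable (by norm_num)
  obtain ⟨F₁, F₁', w₁, p₁, e₁, r₁, b₁⟩ := exists_isSecondPrimitive_of_weak hV (loc hf₁) (loc hh₁) weak₁
  obtain ⟨F₂, F₂', w₂, p₂, e₂, r₂, b₂⟩ := exists_isSecondPrimitive_of_weak hV (loc hf₂) (loc hh₂) weak₂
  have i₁ : Integrable (fun x => h₁ x * f₂ x) halfLine := hh₁.integrable_mul hf₂
  have i₂ : Integrable (fun x => f₁ x * h₂ x) halfLine := hf₁.integrable_mul hh₂
  -- The boundary term at 0 vanishes and the contributions of `V` cancel.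
  have W : ∀ R, 0 ≤ R → F₁' R * F₂ R - F₁ R * F₂' R =
      ∫ x in (0 : ℝ)..R, (f₁ x * h₂ x - h₁ x * f₂ x) := by
    intro R hR
    rw [p₁.wronskian p₂ R, wronskian_eq_zero_of_boundary b₁ b₂, zero_add]
    refine intervalIntegral.integral_congr_ae ?_
    filter_upwards [ae_uIoc_of_ae_halfLine e₁ le_rfl hR, ae_uIoc_of_ae_halfLine e₂ le_rfl hR, ae_uIoc_of_ae_halfLine r₁ le_rfl hR, ae_uIoc_of_ae_halfLine r₂ le_rfl hR] with x q1 q2 q3 q4 hx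
    rw [q1 hx, q2 hx, q3 hx, q4 hx]; ring
  set l := ∫ x, (f₁ x * h₂ x - h₁ x * f₂ x) ∂halfLine with hl
  have lim : Tendsto (fun R => F₁' R * F₂ R - F₁ R * F₂' R) atTop (𝓝 l) := by
    have hI : IntegrableOn (fun x => f₁ x * h₂ x - h₁ x * f₂ x) (Ioi 0) :=
      IntegrableOn.mono_set (i₂.sub i₁) Ioi_subset_Ici_self
    rw [hl, halfLine, integral_Ici_eq_integral_Ioi]
    refine (intervalIntegral_tendsto_integral_Ioi 0 hI tendsto_id).congr' ?_
    filter_upwards [eventually_ge_atTop 0] with R hR using (W R hR).symm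
  have hl0 : l = 0 := by
    by_contra hne
    have hpos : 0 < ‖l‖ := norm_pos_iff.2 hne
    have big : ∀ᶠ R in atTop, ‖l‖ / 2 < ‖F₁' R * F₂ R - F₁ R * F₂' R‖ :=
      lim.norm.eventually (lt_mem_nhds (by linarith))
    have m0 := ((tendsto_integral_norm_unit_interval hf₁).add
      (tendsto_integral_norm_unit_interval hf₂)).add
      ((tendsto_integral_norm_unit_interval hh₁).add (tendsto_integral_norm_unit_interval hh₂))
    have small := ((m0.pow 2).const_mul 126).eventually (gt_mem_nhds
      (show 126 * (0 + 0 + (0 + 0) : ℝ) ^ 2 < ‖l‖ / 2 by rw [add_zero, add_zero]; linarith))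
    -- The point of small Wronskian is only known to lie to the right of `a`, so the lower bound
    -- must hold on a whole half line.
    obtain ⟨N, hN⟩ := (((eventually_forall_ge_atTop.2 big).and small).and
      (eventually_ge_atTop 0)).exists_forall_of_atTop
    obtain ⟨a, haN, ha⟩ := hb N
    obtain ⟨⟨hbig, hsmall⟩, ha0⟩ := hN a haN
    have k₁ := integral_norm_le_of_abs_le_one ha0 ha (loc hf₁) (loc hh₁) r₁ p₁.locallyIntegrable
    have k₂ := integral_norm_le_of_abs_le_one ha0 ha (loc hf₂) (loc hh₂) r₂ p₂.locallyIntegrable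
    have hab : a ≤ a + 1 := by linarith
    have nn : ∀ g : ℝ → ℂ, 0 ≤ ∫ t in a..(a + 1), ‖g t‖ := fun g =>
      intervalIntegral.integral_nonneg hab fun _ _ => norm_nonneg _
    have := nn f₁
    have := nn f₂
    have := nn h₁
    have := nn h₂
    have kF : ∫ t in a..(a + 1), (‖F₁ t‖ + ‖F₂ t‖) =
        (∫ t in a..(a + 1), ‖f₁ t‖) + ∫ t in a..(a + 1), ‖f₂ t‖ := by
      rw [intervalIntegral.integral_add (p₁.continuous.norm.intervalIntegrable _ _)
        (p₂.continuous.norm.intervalIntegrable _ _)]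
      congr 1 <;> refine intervalIntegral.integral_congr_ae ?_
      · filter_upwards [ae_uIoc_of_ae_halfLine e₁ ha0 hab] with x hx hxa
        rw [hx hxa]
      · filter_upwards [ae_uIoc_of_ae_halfLine e₂ ha0 hab] with x hx hxa
        rw [hx hxa]
    obtain ⟨x, hax, hx⟩ := p₁.exists_norm_wronskian_le p₂ (a := a)
      (m := (∫ t in a..(a + 1), ‖f₁ t‖) + (∫ t in a..(a + 1), ‖f₂ t‖) +
        ((∫ t in a..(a + 1), ‖h₁ t‖) + ∫ t in a..(a + 1), ‖h₂ t‖))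
      (by linarith) (by linarith) (by linarith)
    have := hbig x hax
    linarith
  rw [hl, integral_sub i₂ i₁] at hl0
  exact (sub_eq_zero.1 hl0).symm

/-! ### The limit point criterion -/

open ComplexConjugate

theorem inner_eq_integral {f g : L2} {u v : ℝ → ℂ} (hf : f =ᵐ[halfLine] u) (hg : g =ᵐ[halfLine] v) :
    inner ℂ f g = ∫ x, v x * conj (u x) ∂halfLine := by
  rw [MeasureTheory.L2.inner_def]
  refine integral_congr_ae ?_
  filter_upwards [hf, hg] with x h1 h2
  rw [h1, h2, RCLike.inner_apply]

namespace IsTest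

variable {θ : ℝ} {φ ψ : ℝ → ℂ} {V : ℝ → ℝ}

theorem continuous_deriv_deriv (h : IsTest θ φ) : Continuous (deriv (deriv φ)) :=
  (contDiff_infty_iff_deriv.1 (contDiff_infty_iff_deriv.1 h.smooth).2).2.continuous

theorem memLp (h : IsTest θ φ) : MemLp φ 2 halfLine :=
  h.smooth.continuous.memLp_of_hasCompactSupport h.compact

theorem memLp_expr (h : IsTest θ φ) (hV : IsLocallyBounded V) :
    MemLp (expr V φ) 2 halfLine := by
  obtain ⟨M, -, hM⟩ := h.compact.exists_pos_le_norm
  obtain ⟨C, hC⟩ := hV.bounded M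
  have h1 : MemLp (deriv (deriv φ)) 2 halfLine :=
    h.continuous_deriv_deriv.memLp_of_hasCompactSupport h.compact.deriv.deriv
  have h2 : MemLp (fun x => (V x : ℂ) * φ x) 2 halfLine := by
    refine h.memLp.of_le_mul (c := C) ((Complex.measurable_ofReal.comp hV.measurable).mul
      h.smooth.continuous.measurable).aestronglyMeasurable ?_
    filter_upwards [ae_restrict_mem measurableSet_Ici] with x hx
    rcases le_total M x with hMx | hMx
    · simp [hM x (hMx.trans (le_abs_self x))]
    · rw [norm_mul, Complex.norm_real]
      exact mul_le_mul_of_nonneg_right (hC x ⟨hx, hMx⟩) (norm_nonneg _)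
  exact h1.neg.add h2

/-- The differential equation is treated with the bilinear pairing; conjugation, harmless as `V` and
`θ` are real, passes to the inner product. -/
theorem star (h : IsTest θ φ) : IsTest θ (fun x => conj (φ x)) where
  smooth := Complex.conjCLE.contDiff.comp h.smooth
  compact := h.compact.comp_left (map_zero _)
  boundary := by
    have e : deriv (fun x => conj (φ x)) 0 = conj (deriv φ 0) := deriv.star
    have := congrArg conj h.boundary
    rw [e]
    simpa only [map_sub, map_mul, map_zero, Complex.conj_ofReal] using this

theorem expr_star (V : ℝ → ℝ) (φ : ℝ → ℂ) (x : ℝ) :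
    expr V (fun x => conj (φ x)) x = conj (expr V φ x) := by
  have e : ∀ φ : ℝ → ℂ, deriv (fun x => conj (φ x)) = fun x => conj (deriv φ x) :=
    fun φ => funext fun x => deriv.star
  simp only [expr, e, map_add, map_neg, map_mul, Complex.conj_ofReal]

theorem integral_mul_expr (h : IsTest θ φ) (k : IsTest θ ψ) (hV : IsLocallyBounded V) :
    ∫ x, φ x * expr V ψ x ∂halfLine = ∫ x, expr V φ x * ψ x ∂halfLine := by
  obtain ⟨M, hM, z⟩ := h.compact.exists_pos_le_norm
  have z1 : ∀ x, M ≤ x → φ x = 0 := fun x hx => z x (hx.trans (le_abs_self x))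
  have i1 : Integrable (fun x => φ x * expr V ψ x) halfLine := h.memLp.integrable_mul (k.memLp_expr hV)
  have i2 : Integrable (fun x => expr V φ x * ψ x) halfLine := (h.memLp_expr hV).integrable_mul k.memLp
  -- Each differentiation costs a unit, giving room for a neighbourhood on which the previous
  -- function vanishes.
  have d1 : ∀ x, M + 1 ≤ x → deriv φ x = 0 := fun x hx => by
    have : φ =ᶠ[nhds x] fun _ => 0 := by
      filter_upwards [Ioi_mem_nhds (show M < x by linarith)] with y hy using z1 y (le_of_lt hy)
    rw [this.deriv_eq, deriv_const]
  have d2 : ∀ x, M + 2 ≤ x → deriv (deriv φ) x = 0 := fun x hx => by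
    have : deriv φ =ᶠ[nhds x] fun _ => 0 := by
      filter_upwards [Ioi_mem_nhds (show M + 1 < x by linarith)] with y hy using d1 y (le_of_lt hy)
    rw [this.deriv_eq, deriv_const]
  have W := (IsSecondPrimitive.of_contDiff h.smooth).wronskian
    (IsSecondPrimitive.of_contDiff k.smooth) (M + 2)
  rw [wronskian_eq_zero_of_boundary h.boundary k.boundary, z1 _ (by linarith), d1 _ (by linarith),
    ← integral_halfLine_eq (by linarith) fun x hx => by
      rw [z1 x (by linarith), d2 x hx, zero_mul, zero_mul, sub_zero]] at W
  have e : ∀ x, deriv (deriv φ) x * ψ x - φ x * deriv (deriv ψ) x =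
      φ x * expr V ψ x - expr V φ x * ψ x := fun x => by simp only [expr]; ring
  simp only [e] at W
  rw [integral_sub i1 i2] at W
  linear_combination -W

theorem mem_graph (h : IsTest θ φ) (hV : IsLocallyBounded V) :
    (h.memLp.toLp φ, (h.memLp_expr hV).toLp (expr V φ)) ∈ schrodingerGraph V θ :=
  ⟨φ, h, h.memLp.coeFn_toLp, (h.memLp_expr hV).coeFn_toLp⟩

end IsTest

variable {V : ℝ → ℝ} {θ : ℝ}

/-- Smooth functions compactly supported in (0, ∞) satisfy every boundary condition and are already
dense. -/
theorem dense_domain_schrodinger (hV : IsLocallyBounded V) :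
    Dense ((schrodinger V θ).domain : Set L2) := by
  rw [Submodule.dense_iff_topologicalClosure_eq_top, Submodule.topologicalClosure_eq_top_iff,
    Submodule.eq_bot_iff]
  intro f hf
  rw [Submodule.mem_orthogonal] at hf
  have key : ∀ᵐ x ∂halfLine, x ∈ Ioi 0 → f x = 0 := by
    refine isOpen_Ioi.ae_eq_zero_of_integral_contDiff_smul_eq_zero
      (((Lp.memLp f).locallyIntegrable (by norm_num)).locallyIntegrableOn _) fun g hg hc hs => ?_
    have g0 : (0 : ℝ) ∉ tsupport g := fun h => lt_irrefl (0 : ℝ) (hs h)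
    have ev : (fun x => (g x : ℂ)) =ᶠ[nhds 0] fun _ => 0 := by
      filter_upwards [notMem_tsupport_iff_eventuallyEq.1 g0] with x hx
      simp [hx]
    have test : IsTest θ fun x => (g x : ℂ) := by
      refine ⟨Complex.ofRealCLM.contDiff.comp hg, hc.comp_left Complex.ofReal_zero, ?_⟩
      rw [ev.deriv_eq, ev.eq_of_nhds]
      simp
    have hm := test.mem_graph hV
    rw [← schrodinger_graph] at hm
    have := hf _ (LinearPMap.mem_domain_of_mem_graph hm)
    rw [inner_eq_integral test.memLp.coeFn_toLp Filter.EventuallyEq.rfl] at this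
    rw [← this]
    refine integral_congr_ae (.of_forall fun x => ?_)
    simp [mul_comm]
  rw [Lp.eq_zero_iff_ae_eq_zero]
  have h0 : ∀ᵐ x ∂halfLine, x ≠ (0 : ℝ) := ae_restrict_of_ae (by simp [ae_iff])
  filter_upwards [key, h0, ae_restrict_mem measurableSet_Ici] with x hx h1 h2
  exact hx (lt_of_le_of_ne h2 h1.symm)

theorem weak_of_mem_adjoint (hV : IsLocallyBounded V) {p : L2 × L2}
    (hp : p ∈ (schrodinger V θ).graph.adjoint) (φ : ℝ → ℂ) (hφ : IsTest θ φ) :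
    ∫ x, p.1 x * expr V φ x ∂halfLine = ∫ x, p.2 x * φ x ∂halfLine := by
  rw [Submodule.mem_adjoint_iff, schrodinger_graph] at hp
  have := sub_eq_zero.1 (hp _ _ (hφ.star.mem_graph hV))
  rw [inner_eq_integral (hφ.star.memLp_expr hV).coeFn_toLp Filter.EventuallyEq.rfl,
    inner_eq_integral hφ.star.memLp.coeFn_toLp Filter.EventuallyEq.rfl] at this
  simpa only [IsTest.expr_star, Complex.conj_conj] using this

theorem weak_conj {f h : ℝ → ℂ}
    (weak : ∀ φ, IsTest θ φ → ∫ x, f x * expr V φ x ∂halfLine = ∫ x, h x * φ x ∂halfLine)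
    (φ : ℝ → ℂ) (hφ : IsTest θ φ) :
    ∫ x, conj (f x) * expr V φ x ∂halfLine = ∫ x, conj (h x) * φ x ∂halfLine := by
  have := congrArg conj (weak _ hφ.star)
  rw [← integral_conj, ← integral_conj] at this
  simpa only [IsTest.expr_star, map_mul, Complex.conj_conj] using this

theorem isFormalAdjoint_schrodinger (hV : IsLocallyBounded V) :
    (schrodinger V θ).IsFormalAdjoint (schrodinger V θ) := by
  intro x y
  have hx := (schrodinger V θ).mem_graph x
  have hy := (schrodinger V θ).mem_graph y
  rw [schrodinger_graph] at hx hy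
  obtain ⟨φ, hφ, h1, h2⟩ := hx
  obtain ⟨ψ, hψ, k1, k2⟩ := hy
  have e := hψ.integral_mul_expr hφ.star hV
  simp only [IsTest.expr_star] at e
  exact (inner_eq_integral h2 k1).trans (e.trans (inner_eq_integral h1 k2).symm)

/-- The half line operator is essentially self-adjoint if the potential is bounded by one on
unit intervals arbitrarily far out. -/
theorem isEssentiallySelfAdjoint_schrodinger (hV : IsLocallyBounded V)
    (hb : ∀ N : ℝ, ∃ a ≥ N, ∀ x ∈ Ioo a (a + 1), |V x| ≤ 1) (θ : ℝ) :
    IsEssentiallySelfAdjoint (schrodinger V θ) := by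
  refine isEssentiallySelfAdjoint_of_adjoint_symmetric _ (dense_domain_schrodinger hV)
    (isFormalAdjoint_schrodinger hV) fun p hp q hq => ?_
  -- The first pair is conjugated because the inner product is conjugate linear in its first slot.
  have := integral_mul_eq_of_weak hV hb (Lp.memLp p.1).star (Lp.memLp p.2).star (Lp.memLp q.1)
    (Lp.memLp q.2) (weak_conj (weak_of_mem_adjoint hV hp)) (weak_of_mem_adjoint hV hq)
  rw [inner_eq_integral Filter.EventuallyEq.rfl Filter.EventuallyEq.rfl,
    inner_eq_integral Filter.EventuallyEq.rfl Filter.EventuallyEq.rfl]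
  simpa only [mul_comm, Pi.star_apply, starRingEnd_apply] using this

/-! ### The potentials -/

open Filter

section Potential

variable {I : ℕ → Set ℝ} (c : ℕ → ℝ)

theorem tsum_indicator_eq_sum {R : ℝ} {N : ℕ} (hN : ∀ n, N ≤ n → ∀ x ≤ R, x ∉ I n) {x : ℝ}
    (hx : x ≤ R) : ∑' n, (I n).indicator (fun _ => c n) x =
      ∑ n ∈ Finset.range N, (I n).indicator (fun _ => c n) x :=
  tsum_eq_sum fun n hn => indicator_of_notMem (hN n (by simpa using hn) x hx) _

/-- By `hI`, only finitely many terms contribute on each half line (-∞, R]. -/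
theorem isLocallyBounded_tsum_indicator (hm : ∀ n, MeasurableSet (I n))
    (hI : ∀ R : ℝ, ∃ N, ∀ n, N ≤ n → ∀ x ≤ R, x ∉ I n) :
    IsLocallyBounded fun x => ∑' n, (I n).indicator (fun _ => c n) x where
  measurable := by
    refine measurable_of_tendsto_metrizable
      (f := fun N x => ∑ n ∈ Finset.range N, (I n).indicator (fun _ => c n) x)
      (fun N => Finset.measurable_fun_sum _ fun n _ => measurable_const.indicator (hm n)) ?_
    rw [tendsto_pi_nhds]
    intro x
    obtain ⟨N, hN⟩ := hI x
    refine tendsto_const_nhds.congr' ?_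
    filter_upwards [eventually_ge_atTop N] with M hM
    exact tsum_indicator_eq_sum c (fun n hn => hN n (hM.trans hn)) le_rfl
  bounded R := by
    obtain ⟨N, hN⟩ := hI R
    refine ⟨∑ n ∈ Finset.range N, |c n|, fun x hx => ?_⟩
    rw [tsum_indicator_eq_sum c hN hx.2]
    refine (Finset.abs_sum_le_sum_abs _ _).trans (Finset.sum_le_sum fun n _ => ?_)
    by_cases h : x ∈ I n <;> simp [h]

end Potential

theorem isLocallyBounded_potentialII (X : ℕ → ℝ) : IsLocallyBounded (potentialII X) := by
  have h := isLocallyBounded_tsum_indicator (I := fun n : ℕ => Ico (n : ℝ) (n + 1)) X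
    (fun n => measurableSet_Ico) fun R => by
      obtain ⟨N, hN⟩ := exists_nat_gt R
      refine ⟨N, fun n hn x hx h => ?_⟩
      have : (N : ℝ) ≤ n := by exact_mod_cast hn
      linarith [h.1]
  exact ⟨h.measurable.neg, fun R => by simpa only [potentialII, abs_neg] using h.bounded R⟩

theorem potentialII_eq (X : ℕ → ℝ) {n : ℕ} {x : ℝ} (hx : x ∈ Ico (n : ℝ) (n + 1)) :
    potentialII X x = -X n := by
  rw [potentialII, tsum_eq_single n, indicator_of_mem hx]
  intro m hm
  refine indicator_of_notMem (fun h => hm ?_) _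
  have h1 : (m : ℝ) < n + 1 := h.1.trans_lt hx.2
  have h2 : (n : ℝ) < m + 1 := hx.1.trans_lt h.2
  norm_cast at h1 h2
  omega

theorem edge_succ (Y : ℕ → ℝ) (n : ℕ) : edge Y (n + 1) = edge Y n + Y n + 1 := by
  simp only [edge, Finset.sum_range_succ]; push_cast; ring

theorem monotone_edge {Y : ℕ → ℝ} (hY : ∀ n, 0 ≤ Y n) : Monotone (edge Y) :=
  monotone_nat_of_le_succ fun n => by rw [edge_succ]; linarith [hY n]

theorem natCast_le_edge {Y : ℕ → ℝ} (hY : ∀ n, 0 ≤ Y n) (n : ℕ) : (n : ℝ) ≤ edge Y n := by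
  rw [edge]; linarith [Finset.sum_nonneg fun j (_ : j ∈ Finset.range n) => hY j]

theorem isLocallyBounded_potentialIV (X : ℕ → ℝ) {Y : ℕ → ℝ} (hY : ∀ n, 0 ≤ Y n) (ε : ℕ → ℕ) :
    IsLocallyBounded (potentialIV X Y ε) :=
  isLocallyBounded_tsum_indicator (I := fun n => Icc (edge Y (n + 1) - 1) (edge Y (n + 1)))
    (fun n => (-1) ^ ε n * X n) (fun n => measurableSet_Icc) fun R => by
      obtain ⟨N, hN⟩ := exists_nat_gt R
      refine ⟨N, fun n hn x hx h => ?_⟩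
      have h1 : (N : ℝ) ≤ n := by exact_mod_cast hn
      have h2 := natCast_le_edge hY (n + 1)
      push_cast at h2
      linarith [h.1]

/-- The potential of Model IV vanishes in the gaps. -/
theorem potentialIV_eq_zero (X : ℕ → ℝ) {Y : ℕ → ℝ} (hY : ∀ n, 0 ≤ Y n) (ε : ℕ → ℕ) {n : ℕ}
    {x : ℝ} (hx : x ∈ Ioo (edge Y n) (edge Y n + Y n)) : potentialIV X Y ε x = 0 := by
  have h : ∀ m, (Icc (edge Y (m + 1) - 1) (edge Y (m + 1))).indicator
      (fun _ => (-1) ^ ε m * X m) x = 0 := fun m => by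
    refine indicator_of_notMem (fun hm => ?_) _
    -- Bumps `m < n` end by `edge Y n`; bumps `m ≥ n` start no earlier than `edge Y n + Y n`.
    rcases lt_or_ge m n with hmn | hmn
    · linarith [monotone_edge hY (show m + 1 ≤ n from hmn), hm.2, hx.1]
    · linarith [monotone_edge hY (show n + 1 ≤ m + 1 by omega), hm.1, hx.2, edge_succ Y n]
  simp only [potentialIV, h, tsum_zero]

/-! ### Borel-Cantelli -/

section Probability

variable {Ω : Type*} [MeasurableSpace Ω] {P : Measure Ω}

theorem HasDensity.measure_preimage {X : Ω → ℝ} {p : ℝ → ℝ} (h : HasDensity P X p)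
    (hX : Measurable X) {S : Set ℝ} (hS : MeasurableSet S) :
    P (X ⁻¹' S) = ∫⁻ x in S, ENNReal.ofReal (p x) := by
  rw [← Measure.map_apply hX hS, h, withDensity_apply _ hS]

theorem ae_frequently_mem_of_hasDensity {X : ℕ → Ω → ℝ} {p : ℝ → ℝ}
    (hX : ∀ n, Measurable (X n)) (hi : iIndepFun X P) (hd : ∀ n, HasDensity P (X n) p)
    (hp : Measurable p) (hpos : ∀ x, 0 < x → 0 < p x) {S : Set ℝ} (hS : MeasurableSet S)
    {a b : ℝ} (ha : 0 ≤ a) (hab : a < b) (hsub : Ioo a b ⊆ S) :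
    ∀ᵐ ω ∂P, ∃ᶠ n in atTop, X n ω ∈ S := by
  have : IsProbabilityMeasure P := hi.isProbabilityMeasure
  have hm : ∀ n, MeasurableSet (X n ⁻¹' S) := fun n => hX n hS
  have hI : iIndepSet (fun n => X n ⁻¹' S) P := by
    rw [iIndepSet_iff_meas_biInter hm]
    intro s
    exact hi.measure_inter_preimage_eq_mul s fun _ _ => hS
  -- All the events have this same probability, positive since `p > 0` on `Ioo a b`; hence the
  -- series diverges.
  have hc : 0 < ∫⁻ x in S, ENNReal.ofReal (p x) := by
    rw [setLIntegral_pos_iff hp.ennreal_ofReal]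
    refine lt_of_lt_of_le ?_ (measure_mono (show Ioo a b ⊆ _ from fun x hx => ⟨?_, hsub hx⟩))
    · simpa using hab
    · simpa using hpos x (ha.trans_lt hx.1)
  have hlim := measure_limsup_eq_one hm hI (by
    simp only [(hd _).measure_preimage (hX _) hS]
    exact ENNReal.tsum_const_eq_top_of_ne_zero hc.ne')
  have hae := (prob_compl_eq_zero_iff (MeasurableSet.measurableSet_limsup hm)).2 hlim
  filter_upwards [mem_ae_iff.2 hae] with ω hω
  exact mem_limsup_iff_frequently_mem.1 hω

theorem HasDensity.ae_nonneg {X : Ω → ℝ} {p : ℝ → ℝ} (h : HasDensity P X p) (hX : Measurable X)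
    (hp : ∀ x, x < 0 → p x = 0) : ∀ᵐ ω ∂P, 0 ≤ X ω := by
  have h0 : P (X ⁻¹' Iio 0) = 0 := by
    rw [h.measure_preimage hX measurableSet_Iio]
    exact (setLIntegral_congr_fun measurableSet_Iio fun x hx => by simp [hp x hx]).trans
      lintegral_zero
  rw [ae_iff]
  simp only [not_le]
  exact h0

theorem IsModelII.ae_isEssentiallySelfAdjoint {X : ℕ → Ω → ℝ} {p : ℝ → ℝ} (h : IsModelII P X p) :
    ∀ᵐ ω ∂P, ∀ θ : ℝ, IsEssentiallySelfAdjoint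
      (schrodinger (potentialII fun n => X n ω) θ) := by
  filter_upwards [ae_frequently_mem_of_hasDensity h.measurable h.indep h.density
    h.continuous.measurable h.pos (measurableSet_Icc (a := -1) (b := 1)) le_rfl one_pos
    fun x hx => ⟨by linarith [hx.1], hx.2.le⟩] with ω hω θ
  refine isEssentiallySelfAdjoint_schrodinger (isLocallyBounded_potentialII _) (fun N => ?_) θ
  obtain ⟨M, hM⟩ := exists_nat_ge N
  obtain ⟨n, hn, hX⟩ := frequently_atTop.1 hω M
  refine ⟨n, hM.trans (by exact_mod_cast hn), fun x hx => ?_⟩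
  rw [potentialII_eq _ (Ioo_subset_Ico_self hx), abs_neg]
  exact abs_le.2 hX

theorem IsModelIV.ae_isEssentiallySelfAdjoint {X Y : ℕ → Ω → ℝ} {ε : ℕ → Ω → ℕ} {p₁ p₂ : ℝ → ℝ}
    (h : IsModelIV P X Y ε p₁ p₂) :
    ∀ᵐ ω ∂P, ∀ θ : ℝ, IsEssentiallySelfAdjoint
      (schrodinger (potentialIV (fun n => X n ω) (fun n => Y n ω) fun n => ε n ω) θ) := by
  filter_upwards [ae_frequently_mem_of_hasDensity h.measurable_Y h.indep_Y h.density_Y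
    h.measurable_p₂ h.pos_p₂ (measurableSet_Ici (a := 1)) zero_le_one one_lt_two
    fun x hx => hx.1.le, ae_all_iff.2 fun n => (h.density_Y n).ae_nonneg (h.measurable_Y n) h.zero_p₂]
    with ω hω hY θ
  refine isEssentiallySelfAdjoint_schrodinger (isLocallyBounded_potentialIV _ hY _) (fun N => ?_) θ
  obtain ⟨M, hM⟩ := exists_nat_ge N
  obtain ⟨n, hn, hn1⟩ := frequently_atTop.1 hω M
  have hMn : (M : ℝ) ≤ n := by exact_mod_cast hn
  -- The good interval starts at the left end of a gap of length at least 1.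
  refine ⟨edge (fun n => Y n ω) n, (hM.trans hMn).trans (natCast_le_edge hY n), fun x hx => ?_⟩
  rw [potentialIV_eq_zero _ hY _ ⟨hx.1, hx.2.trans_le (add_le_add_right hn1 _)⟩, abs_zero]
  exact zero_le_one

end Probability

end KronigPenny

theorem mainTheorem7 {Ω : Type*} [MeasurableSpace Ω] (P : Measure Ω) [IsProbabilityMeasure P] :
    (∀ (X : ℕ → Ω → ℝ) (p : ℝ → ℝ), KronigPenny.IsModelII P X p →
      ∀ᵐ ω ∂P, ∀ θ₀ : ℝ, KronigPenny.IsEssentiallySelfAdjoint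
        (KronigPenny.schrodinger (KronigPenny.potentialII fun n => X n ω) θ₀)) ∧
    (∀ (X Y : ℕ → Ω → ℝ) (ε : ℕ → Ω → ℕ) (p₁ p₂ : ℝ → ℝ), KronigPenny.IsModelIV P X Y ε p₁ p₂ →
      ∀ᵐ ω ∂P, ∀ θ₀ : ℝ, KronigPenny.IsEssentiallySelfAdjoint
        (KronigPenny.schrodinger
          (KronigPenny.potentialIV (fun n => X n ω) (fun n => Y n ω) fun n => ε n ω) θ₀)) :=
  ⟨fun _ _ h => h.ae_isEssentiallySelfAdjoint, fun _ _ _ _ _ h => h.ae_isEssentiallySelfAdjoint⟩
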